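/- Let $A$ be an integer $n\times n$ matrix all of whose complex eigenvalues have modulus greater than $1$. For a finite set $D\subset\mathbb{Z}^n$ let $$T(A,D)=\Big\{\sum_{k\ge 1}A^{-k}d_k : d_k\in D\Big\}\subset\mathbb{R}^n .$$ If $D\neq\emptyset$, then $T(A,D)$ is the unique nonempty compact set $T\subset\mathbb{R}^n$ with $A(T)=\bigcup_{d\in D}(T+d)$. Let $D_1,D_2\subset\mathbb{Z}^n$ be finite, and put $T_i=T(A,D_i)$. Let $C\subset\mathbb{Z}^n$ be a coset transversal for $\mathbb{Z}^n/A(\mathbb{Z}^n)$ (every element of $\mathbb{Z}^n$ is congruent modulo $A(\mathbb{Z}^n)$ to exactly one element of $C$), and let $E\subset\mathbb{Z}^n$ be a finite set containing $D_1$, $D_2$ and $C$. Let $\Gamma=\Gamma(A,E)$ be the directed labeled graph with vertex set $\mathbb{Z}^n$ and with an edge from $u$ to $v$ labeled by $(x,y)\in E\times E$ whenever $u+x=y+Av$. Its nucleus $\mathcal{N}$ is the subgraph spanned by all vertices that lie on directed cycles of $\Gamma$ or can be reached along directed paths from such cycles. Let $\mathcal{N}_{D_i}$ be the graph labeled by $C$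 that is obtained from $\mathcal{N}$ by keeping only the edges with label $(a,b)\in C\times D_i$ and replacing each such label by $a$. For a vertex $v$ of $\mathcal{N}$ let $F^{(i)}_v\subset C^{-\omega}$ be the set of left-infinite sequences $\ldots x_2x_1$ over $C$ that can be read along left-infinite paths in $\mathcal{N}_{D_i}$ ending in $v$. Let $\mu$ be the uniform Bernoulli measure on $C^{-\omega}$ (the product of the uniform probability measures on $C$), and let $\lambda$ be Lebesgue measure on $\mathbb{R}^n$. Then $\mathcal{N}$ is finite, the sets $F^{(i)}_v$ are closed in $C^{-\omega}$, and $$\lambda(T_1\cap T_2)=\sum_{v\in\mathcal{N}}\mu\big(F^{(1)}_v\cap F^{(2)}_v\big).$$ Moreover, the intersections are obtained from the labeled product of the graphs $\mathcal{N}_{D_1}$ and $\mathcal{N}_{D_2}$, that is, the finite graph with vertex set $\mathcal{N}\times\mathcal{N}$ and with an edge $(u_1,u_2)\xrightarrow{x}(w_1,w_2)$ whenever $u_i\xrightarrow{x}w_i$ is an edge of $\mathcal{N}_{D_i}$ for $i=1,2$: for all vertices $v_1,v_2$ of $\mathcal{N}$, the set $F_{(v_1,v_2)}$ of left-infinite sequences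 that can be read along left-infinite paths in the product graph ending in $(v_1,v_2)$ satisfies $$F_{(v_1,v_2)}=F^{(1)}_{v_1}\cap F^{(2)}_{v_2}.$$ -/

import Mathlib

open MeasureTheory
open scoped Matrix

namespace SelfAffine

/-- An integer matrix is expanding if every complex eigenvalue has modulus greater than `1`. -/
def IsExpanding {n : ℕ} (A : Matrix (Fin n) (Fin n) ℤ) : Prop :=
  ∀ z : ℂ, Module.End.HasEigenvalue (Matrix.toLin' (A.map (Int.cast : ℤ → ℂ))) z → 1 < ‖z‖

/-- The integer matrix `A`, viewed as a real matrix. -/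
def realMat {n : ℕ} (A : Matrix (Fin n) (Fin n) ℤ) : Matrix (Fin n) (Fin n) ℝ :=
  A.map (Int.cast : ℤ → ℝ)

/-- The inclusion of `ℤⁿ` in `ℝⁿ`. -/
def realVec {n : ℕ} (d : Fin n → ℤ) : Fin n → ℝ :=
  fun i => (d i : ℝ)

/-- The self-affine set `T(A, D)`, that is, the set of all sums `∑_{k ≥ 1} A⁻ᵏ d_k` with digits
`d_k ∈ D`; the digit `d_{k+1}` is `d k` here. -/
def selfAffineSet {n : ℕ} (A : Matrix (Fin n) (Fin n) ℤ) (D : Finset (Fin n → ℤ)) :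
    Set (Fin n → ℝ) :=
  {x | ∃ d : ℕ → (Fin n → ℤ), (∀ k, d k ∈ D) ∧
    HasSum (fun k : ℕ => ((realMat A)⁻¹ ^ (k + 1)) *ᵥ realVec (d k)) x}

/-- `T` is a nonempty compact set with `A(T) = ⋃_{d ∈ D} (T + d)`. -/
def IsSelfAffine {n : ℕ} (A : Matrix (Fin n) (Fin n) ℤ) (D : Finset (Fin n → ℤ))
    (T : Set (Fin n → ℝ)) : Prop :=
  IsCompact T ∧ T.Nonempty ∧
    (fun x => realMat A *ᵥ x) '' T = ⋃ d ∈ D, (fun x => x + realVec d) '' T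

/-- `C` is a coset transversal for `ℤⁿ / A(ℤⁿ)`: every integer vector is congruent modulo `A(ℤⁿ)`
to exactly one element of `C`. -/
def IsCosetTransversal {n : ℕ} (A : Matrix (Fin n) (Fin n) ℤ) (C : Finset (Fin n → ℤ)) : Prop :=
  ∀ z : Fin n → ℤ, ∃! c : Fin n → ℤ, c ∈ C ∧ ∃ w : Fin n → ℤ, z = c + A *ᵥ w

/-- The edges of the graph `Γ(A, K)` on `ℤⁿ`: there is an edge from `u` to `v` labeled by the pair
`(x, y)`, for `x, y ∈ K`, if `u + x = y + A v`. -/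
def GammaEdge {n : ℕ} (A : Matrix (Fin n) (Fin n) ℤ) (K : Finset (Fin n → ℤ))
    (u x y v : Fin n → ℤ) : Prop :=
  x ∈ K ∧ y ∈ K ∧ u + x = y + A *ᵥ v

/-- `u` and `v` are joined by a directed edge of `Γ(A, K)`, with some label. -/
def GammaAdj {n : ℕ} (A : Matrix (Fin n) (Fin n) ℤ) (K : Finset (Fin n → ℤ))
    (u v : Fin n → ℤ) : Prop :=
  ∃ x y, GammaEdge A K u x y v

/-- The vertices of the nucleus of `Γ(A, K)`: those lying on a directed cycle (a closed path of
positive length) or reachable along a directed path from a vertex on a cycle. -/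
def nucleus {n : ℕ} (A : Matrix (Fin n) (Fin n) ℤ) (K : Finset (Fin n → ℤ)) :
    Set (Fin n → ℤ) :=
  {v | ∃ w, Relation.TransGen (GammaAdj A K) w w ∧ Relation.ReflTransGen (GammaAdj A K) w v}

/-- A directed graph with vertices `V` and edges labeled by elements of `L`; `Edge u a v` means that
there is an edge from `u` to `v` labeled by `a`. -/
structure LabeledGraph (V L : Type*) where
  Edge : V → L → V → Prop

namespace LabeledGraph

/-- The left-infinite sequences `… x₂ x₁` which can be read along a left-infinite path that ends
in `v`; here `x_{k+1}` is `x k` and the path is `… → p 2 → p 1 → p 0 = v`. -/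
def leftLanguage {V L : Type*} (G : LabeledGraph V L) (v : V) : Set (ℕ → L) :=
  {x | ∃ p : ℕ → V, p 0 = v ∧ ∀ k, G.Edge (p (k + 1)) (x k) (p k)}

/-- The labeled product of two graphs labeled by the same alphabet. -/
def prod {V₁ V₂ L : Type*} (G₁ : LabeledGraph V₁ L) (G₂ : LabeledGraph V₂ L) :
    LabeledGraph (V₁ × V₂) L where
  Edge u a w := G₁.Edge u.1 a w.1 ∧ G₂.Edge u.2 a w.2

end LabeledGraph

/-- The graph `𝒩_D`: from the nucleus of `Γ(A, K)`, keep the edges with label `(a, b) ∈ C × D`, and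
replace the label `(a, b)` by `a`. -/
def nucleusGraph {n : ℕ} (A : Matrix (Fin n) (Fin n) ℤ) (K C D : Finset (Fin n → ℤ)) :
    LabeledGraph (nucleus A K) C where
  Edge u a v := ∃ b ∈ D, GammaEdge A K u a b v

/-- The uniform Bernoulli measure on the space of left-infinite sequences over `C`: the product of
the uniform probability measures on `C`. -/
noncomputable def bernoulli {n : ℕ} (C : Finset (Fin n → ℤ)) : Measure (ℕ → C) :=
  Measure.infinitePi (fun _ : ℕ => ProbabilityTheory.uniformOn (Set.univ : Set C))

end SelfAffine

/-! Write [x] = ∑ A⁻ᵏ x_k. Along a left-infinite path p in Γ with labels (x_k, d_k), the edge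
relation reads A p_k = p_{k+1} + x_k - d_k. Since A expands, a bounded sequence obeying this
recursion is forced to be p_k = [tail of x] - [tail of d]. Hence x ∈ F_v^{(i)} iff [x] - v ∈ T_i
(`mem_leftLanguage_iff`). Conversely, every v admitting such an x starts a bounded path backwards,
so it lies in the nucleus (`exists_mem_leftLanguage`).

The right-hand side is therefore ∑_{v ∈ ℤⁿ} μ{x : [x] - v ∈ T₁ ∩ T₂}, that is, m(T₁ ∩ T₂), where m
is the law of [x] summed over all integer translates. It remains to see that m is Lebesgue measure.
It is ℤⁿ-invariant. Because C is a transversal, splitting off the first digit gives m(B) = |C|⁻¹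
m(AB) (`periodizedMeasure_scale`), so m is also invariant under every A⁻ʲℤⁿ. These lattices have
dense union, so m is translation invariant, and the unit cube has mass 1. Uniqueness of Haar measure
concludes. -/

namespace SelfAffine

open Filter Topology

/-! ### Summability of the powers of A⁻¹ -/

section PowerBound

/-- In a complex Banach algebra, the powers of an element of spectral radius less than `1` are
absolutely summable. -/
theorem summable_norm_pow_of_spectralRadius_lt_one {R : Type*} [NormedRing R] [NormedAlgebra ℂ R]
    [CompleteSpace R] {a : R} (ha : spectralRadius ℂ a < 1) : Summable fun k : ℕ => ‖a ^ k‖ := by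
  obtain ⟨r, har, hr⟩ := ENNReal.lt_iff_exists_nnreal_btwn.1 ha
  have hr1 : r < 1 := by exact_mod_cast hr
  -- Gelfand's formula: eventually ‖a ^ k‖ ≤ r ^ k, a convergent geometric series.
  have hlim := (spectrum.pow_nnnorm_pow_one_div_tendsto_nhds_spectralRadius a).eventually_lt_const
    har
  refine Summable.of_norm_bounded_eventually_nat
    (summable_geometric_of_lt_one r.coe_nonneg (by exact_mod_cast hr1)) ?_
  filter_upwards [hlim, eventually_gt_atTop 0] with k hk hk0
  rw [norm_norm]
  have hk' : (0 : ℝ) < k := by exact_mod_cast hk0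
  have h1 : (‖a ^ k‖₊ : ENNReal) ≤ (r : ENNReal) ^ k := by
    have := ENNReal.rpow_le_rpow hk.le hk'.le
    rwa [← ENNReal.rpow_mul, one_div, inv_mul_cancel₀ hk'.ne', ENNReal.rpow_one,
      ENNReal.rpow_natCast] at this
  exact_mod_cast h1

/-- The inverse of a complex matrix all of whose eigenvalues have modulus greater than `1` has
spectral radius less than `1`. -/
theorem spectralRadius_inv_lt_one {m : Type*} [Fintype m] [DecidableEq m] {B : Matrix m m ℂ}
    (hB : ∀ z ∈ spectrum ℂ B, 1 < ‖z‖) : IsUnit B ∧ spectralRadius ℂ B⁻¹ < 1 := by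
  have hunit : IsUnit B := by
    by_contra h
    have := hB 0 ((spectrum.zero_mem_iff ℂ).2 h)
    simp at this
    linarith
  refine ⟨hunit, ?_⟩
  rcases isEmpty_or_nonempty m with hm | hm
  · simp [spectralRadius]
  · open scoped Matrix.Norms.Operator in
    refine spectrum.spectralRadius_lt_of_forall_lt (B⁻¹) (r := 1) fun z hz => ?_
    obtain ⟨u, rfl⟩ := hunit
    have hz0 : z ≠ 0 := by
      rintro rfl
      exact (spectrum.zero_mem_iff ℂ).1 hz (Matrix.coe_units_inv u ▸ Units.isUnit _)
    have := (spectrum.inv_mem_iff (r := Units.mk0 z hz0) (a := u⁻¹)).1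
      (by simpa [Matrix.coe_units_inv] using hz)
    have := hB z⁻¹ (by simpa using this)
    rw [norm_inv] at this
    have h := (one_lt_inv₀ (norm_pos_iff.2 hz0)).1 this
    exact_mod_cast h

variable {n : ℕ} {A : Matrix (Fin n) (Fin n) ℤ}

theorem IsExpanding.one_lt_norm (hA : IsExpanding A) (z : ℂ)
    (hz : z ∈ spectrum ℂ (A.map (Int.cast : ℤ → ℂ))) : 1 < ‖z‖ :=
  hA z (Module.End.hasEigenvalue_iff_mem_spectrum.2 (by rwa [Matrix.spectrum_toLin']))

theorem IsExpanding.det_ne_zero (hA : IsExpanding A) : A.det ≠ 0 := by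
  have h := (Matrix.isUnit_iff_isUnit_det _).1 (spectralRadius_inv_lt_one hA.one_lt_norm).1
  intro h0
  have : (A.map (Int.cast : ℤ → ℂ)).det = ((A.det : ℤ) : ℂ) :=
    (Int.cast_det A).symm
  rw [this, h0] at h
  simp at h

theorem det_realMat (A : Matrix (Fin n) (Fin n) ℤ) : (realMat A).det = (A.det : ℝ) :=
  (Int.cast_det A).symm

theorem IsExpanding.isUnit_det (hA : IsExpanding A) : IsUnit (realMat A).det := by
  rw [det_realMat, isUnit_iff_ne_zero]
  exact_mod_cast hA.det_ne_zero

theorem map_ofReal_realMat (A : Matrix (Fin n) (Fin n) ℤ) :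
    (realMat A).map (Complex.ofRealHom) = A.map (Int.cast : ℤ → ℂ) := by
  ext i j; simp [realMat]

/-- The powers of the inverse of an expanding matrix are bounded by a summable sequence. -/
theorem IsExpanding.exists_summable_bound (hA : IsExpanding A) :
    ∃ a : ℕ → ℝ, Summable a ∧ (∀ k, 0 ≤ a k) ∧
      ∀ k x, ‖(realMat A)⁻¹ ^ k *ᵥ x‖ ≤ a k * ‖x‖ := by
  -- The bound is the sup-operator norm of the complexified power: the spectral argument lives over
  -- ℂ, and ℝⁿ → ℂⁿ is isometric for the sup norm.
  open scoped Matrix.Norms.Operator in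
  refine ⟨fun k => ‖(A.map (Int.cast : ℤ → ℂ))⁻¹ ^ k‖,
    summable_norm_pow_of_spectralRadius_lt_one (spectralRadius_inv_lt_one hA.one_lt_norm).2,
    fun k => norm_nonneg _, fun k x => ?_⟩
  have hmap : (A.map (Int.cast : ℤ → ℂ))⁻¹ = ((realMat A)⁻¹).map Complex.ofRealHom := by
    apply Matrix.inv_eq_left_inv
    rw [← map_ofReal_realMat, ← Matrix.map_mul, Matrix.nonsing_inv_mul _ hA.isUnit_det]
    simp
  have hpow : (A.map (Int.cast : ℤ → ℂ))⁻¹ ^ k = ((realMat A)⁻¹ ^ k).map Complex.ofRealHom := by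
    rw [hmap, ← RingHom.mapMatrix_apply, ← RingHom.mapMatrix_apply, map_pow]
  have hnorm : ∀ y : Fin n → ℝ, ‖(fun i => (y i : ℂ))‖ = ‖y‖ := fun y => by
    simp [Pi.norm_def]
  have hmul : (A.map (Int.cast : ℤ → ℂ))⁻¹ ^ k *ᵥ (fun i => (x i : ℂ)) =
      fun i => (((realMat A)⁻¹ ^ k *ᵥ x) i : ℂ) := by
    rw [hpow]
    ext i
    simp [Matrix.mulVec, dotProduct]
  have := Matrix.linfty_opNorm_mulVec ((A.map (Int.cast : ℤ → ℂ))⁻¹ ^ k) (fun i => (x i : ℂ))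
  rwa [hmul, hnorm, hnorm] at this

end PowerBound

end SelfAffine

namespace SelfAffine

open Filter Topology

/-! ### Digit expansions and the self-affine set -/

section DigitSum

variable {n : ℕ} {A : Matrix (Fin n) (Fin n) ℤ}

@[simp]
theorem realVec_add (u v : Fin n → ℤ) : realVec (u + v) = realVec u + realVec v := by
  ext i; simp [realVec]

@[simp]
theorem realVec_sub (u v : Fin n → ℤ) : realVec (u - v) = realVec u - realVec v := by
  ext i; simp [realVec]

@[simp]
theorem realVec_mulVec (A : Matrix (Fin n) (Fin n) ℤ) (v : Fin n → ℤ) :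
    realVec (A *ᵥ v) = realMat A *ᵥ realVec v := by
  ext i; simp [realVec, realMat, Matrix.mulVec, dotProduct]

theorem realVec_injective : Function.Injective (realVec : (Fin n → ℤ) → Fin n → ℝ) := by
  intro u v h
  ext i
  have := congrFun h i
  simpa [realVec] using this

theorem finite_setOf_norm_realVec_le (R : ℝ) : {v : Fin n → ℤ | ‖realVec v‖ ≤ R}.Finite := by
  refine (Set.finite_Icc (fun _ : Fin n => -⌈R⌉) (fun _ => ⌈R⌉)).subset fun v hv => ?_
  have h : ∀ i, |(v i : ℝ)| ≤ R := fun i => (norm_le_pi_norm (realVec v) i).trans hv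
  refine ⟨fun i => ?_, fun i => ?_⟩
  · have h1 := (abs_le.1 (h i)).1
    have h2 : (-⌈R⌉ : ℝ) ≤ v i := by linarith [Int.le_ceil R]
    exact_mod_cast h2
  · have h1 := (abs_le.1 (h i)).2
    have h2 : (v i : ℝ) ≤ ⌈R⌉ := by linarith [Int.le_ceil R]
    exact_mod_cast h2

theorem exists_norm_realVec_le {S : Set (Fin n → ℤ)} (hS : S.Finite) :
    ∃ R, 0 ≤ R ∧ ∀ v ∈ S, ‖realVec v‖ ≤ R := by
  obtain ⟨R, hR⟩ := (hS.image fun v => ‖realVec v‖).bddAbove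
  exact ⟨max R 0, le_max_right _ _, fun v hv =>
    (hR (Set.mem_image_of_mem _ hv)).trans (le_max_left _ _)⟩

theorem IsExpanding.mulVec_inv_mulVec (hA : IsExpanding A) (x : Fin n → ℝ) :
    realMat A *ᵥ ((realMat A)⁻¹ *ᵥ x) = x := by
  rw [Matrix.mulVec_mulVec, Matrix.mul_nonsing_inv _ hA.isUnit_det, Matrix.one_mulVec]

theorem IsExpanding.inv_mulVec_mulVec (hA : IsExpanding A) (x : Fin n → ℝ) :
    (realMat A)⁻¹ *ᵥ (realMat A *ᵥ x) = x := by
  rw [Matrix.mulVec_mulVec, Matrix.nonsing_inv_mul _ hA.isUnit_det, Matrix.one_mulVec]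

theorem IsExpanding.mulVec_injective (hA : IsExpanding A) :
    Function.Injective (fun x => realMat A *ᵥ x) :=
  Function.LeftInverse.injective hA.inv_mulVec_mulVec

/-- The sum `∑_{k ≥ 1} A⁻ᵏ d_k` for a sequence of digits; the digit `d_{k+1}` is `d k` here. -/
noncomputable def digitSum (A : Matrix (Fin n) (Fin n) ℤ) (d : ℕ → Fin n → ℤ) : Fin n → ℝ :=
  ∑' k : ℕ, ((realMat A)⁻¹ ^ (k + 1)) *ᵥ realVec (d k)

theorem IsExpanding.hasSum_digitSum (hA : IsExpanding A) {D : Finset (Fin n → ℤ)}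
    {d : ℕ → Fin n → ℤ} (hd : ∀ k, d k ∈ D) :
    HasSum (fun k : ℕ => ((realMat A)⁻¹ ^ (k + 1)) *ᵥ realVec (d k)) (digitSum A d) := by
  obtain ⟨a, ha, ha0, hbound⟩ := hA.exists_summable_bound
  obtain ⟨R, -, hR⟩ := exists_norm_realVec_le D.finite_toSet
  refine (Summable.of_norm_bounded (g := fun k => a (k + 1) * R)
    (((summable_nat_add_iff 1).2 ha).mul_right R) fun k => ?_).hasSum
  exact (hbound _ _).trans (mul_le_mul_of_nonneg_left (hR _ (hd k)) (ha0 _))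

theorem IsExpanding.mem_selfAffineSet (hA : IsExpanding A) {D : Finset (Fin n → ℤ)}
    {x : Fin n → ℝ} :
    x ∈ selfAffineSet A D ↔ ∃ d : ℕ → Fin n → ℤ, (∀ k, d k ∈ D) ∧ digitSum A d = x :=
  exists_congr fun _ => and_congr_right fun hd =>
    ⟨fun h => (hA.hasSum_digitSum hd).unique h, fun h => h ▸ hA.hasSum_digitSum hd⟩

theorem IsExpanding.continuous_digitSum (hA : IsExpanding A) (D : Finset (Fin n → ℤ)) :
    Continuous fun x : ℕ → D => digitSum A fun k => x k := by
  obtain ⟨a, ha, ha0, hbound⟩ := hA.exists_summable_bound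
  obtain ⟨R, -, hR⟩ := exists_norm_realVec_le D.finite_toSet
  refine continuous_tsum (u := fun k => a (k + 1) * R) (fun k => ?_)
    (((summable_nat_add_iff 1).2 ha).mul_right R) fun k x => ?_
  · exact (continuous_of_discreteTopology
      (f := fun c : D => (realMat A)⁻¹ ^ (k + 1) *ᵥ realVec (c : Fin n → ℤ))).comp
      (continuous_apply k)
  · exact (hbound _ _).trans (mul_le_mul_of_nonneg_left (hR _ (x k).2) (ha0 _))

theorem IsExpanding.isCompact_selfAffineSet (hA : IsExpanding A) (D : Finset (Fin n → ℤ)) :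
    IsCompact (selfAffineSet A D) := by
  have : selfAffineSet A D = Set.range fun x : ℕ → D => digitSum A fun k => x k := by
    ext x
    rw [hA.mem_selfAffineSet]
    exact ⟨fun ⟨d, hd, h⟩ => ⟨fun k => ⟨d k, hd k⟩, h⟩, fun ⟨d, h⟩ => ⟨_, fun k => (d k).2, h⟩⟩
  rw [this]
  exact isCompact_range (hA.continuous_digitSum D)

/-- Multiplication by A shifts the expansion and releases its first digit; all later recursions rest
on this. -/
theorem IsExpanding.mulVec_digitSum (hA : IsExpanding A) {D : Finset (Fin n → ℤ)}
    {d : ℕ → Fin n → ℤ} (hd : ∀ k, d k ∈ D) :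
    realMat A *ᵥ digitSum A d = digitSum A (fun k => d (k + 1)) + realVec (d 0) := by
  have h1 := (hA.hasSum_digitSum hd).map (Matrix.mulVecLin (realMat A))
    (LinearMap.continuous_of_finiteDimensional _)
  rw [← hasSum_nat_add_iff' 1] at h1
  have h2 := hA.hasSum_digitSum fun k => hd (k + 1)
  have hfun : (fun k => ((Matrix.mulVecLin (realMat A)) ∘
      fun k : ℕ => ((realMat A)⁻¹ ^ (k + 1)) *ᵥ realVec (d k)) (k + 1)) =
      fun k => ((realMat A)⁻¹ ^ (k + 1)) *ᵥ realVec (d (k + 1)) := by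
    ext1 k
    simp only [Function.comp_apply, Matrix.mulVecLin_apply]
    rw [pow_succ' _ (k + 1), ← Matrix.mulVec_mulVec, hA.mulVec_inv_mulVec]
  rw [hfun] at h1
  have h3 := h1.unique h2
  simp only [Matrix.mulVecLin_apply, Finset.range_one, Finset.sum_singleton,
    Function.comp_apply, zero_add, pow_one, hA.mulVec_inv_mulVec] at h3
  rw [← h3, sub_add_cancel]

theorem IsExpanding.tendsto_pow_mulVec (hA : IsExpanding A) {y : ℕ → Fin n → ℝ} {R : ℝ}
    (hR : ∀ k, ‖y k‖ ≤ R) : Tendsto (fun k => (realMat A)⁻¹ ^ k *ᵥ y k) atTop (𝓝 0) := by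
  obtain ⟨a, ha, ha0, hbound⟩ := hA.exists_summable_bound
  refine squeeze_zero_norm (a := fun k => a k * R) (fun k => ?_)
    (by simpa using ha.tendsto_atTop_zero.mul_const R)
  exact (hbound _ _).trans (mul_le_mul_of_nonneg_left (hR k) (ha0 k))

/-- A bounded sequence with `A y_k = y_{k+1} + d_k` starts at the point with digits `d_k`. -/
theorem IsExpanding.eq_digitSum_of_bounded (hA : IsExpanding A) {D : Finset (Fin n → ℤ)}
    {d : ℕ → Fin n → ℤ} (hd : ∀ k, d k ∈ D) {y : ℕ → Fin n → ℝ} {R : ℝ} (hR : ∀ k, ‖y k‖ ≤ R)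
    (hy : ∀ k, realMat A *ᵥ y k = y (k + 1) + realVec (d k)) : y 0 = digitSum A d := by
  -- The recursion telescopes, and the remainder A⁻ᵐ y_m vanishes in the limit because y is bounded.
  have key : ∀ m, ∑ k ∈ Finset.range m, (realMat A)⁻¹ ^ (k + 1) *ᵥ realVec (d k) =
      y 0 - (realMat A)⁻¹ ^ m *ᵥ y m := by
    intro m
    induction m with
    | zero => simp
    | succ m ih =>
      have : y m = (realMat A)⁻¹ *ᵥ (y (m + 1) + realVec (d m)) := by
        rw [← hy, hA.inv_mulVec_mulVec]
      rw [Finset.sum_range_succ, ih, this, Matrix.mulVec_mulVec, ← pow_succ, Matrix.mulVec_add]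
      abel
  have h1 := (hA.hasSum_digitSum hd).tendsto_sum_nat
  simp_rw [key] at h1
  have h2 := (tendsto_const_nhds (x := y 0)).sub (hA.tendsto_pow_mulVec hR)
  rw [sub_zero] at h2
  exact tendsto_nhds_unique h2 h1

theorem IsExpanding.isSelfAffine_selfAffineSet (hA : IsExpanding A) {D : Finset (Fin n → ℤ)}
    (hD : D.Nonempty) : IsSelfAffine A D (selfAffineSet A D) := by
  refine ⟨hA.isCompact_selfAffineSet D, ?_, ?_⟩
  · obtain ⟨c, hc⟩ := hD
    exact ⟨_, hA.mem_selfAffineSet.2 ⟨fun _ => c, fun _ => hc, rfl⟩⟩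
  · ext x
    simp only [Set.mem_image, Set.mem_iUnion, exists_prop]
    constructor
    · rintro ⟨y, hy, rfl⟩
      obtain ⟨d, hd, rfl⟩ := hA.mem_selfAffineSet.1 hy
      exact ⟨d 0, hd 0, _, hA.mem_selfAffineSet.2 ⟨_, fun k => hd (k + 1), rfl⟩,
        (hA.mulVec_digitSum hd).symm⟩
    · rintro ⟨c, hc, y, hy, rfl⟩
      obtain ⟨d, hd, rfl⟩ := hA.mem_selfAffineSet.1 hy
      have hd' : ∀ k, (fun k => Nat.casesOn k c d : ℕ → Fin n → ℤ) k ∈ D := by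
        rintro (_ | k)
        exacts [hc, hd k]
      exact ⟨_, hA.mem_selfAffineSet.2 ⟨_, hd', rfl⟩, hA.mulVec_digitSum hd'⟩

/-- Each point of T has a digit and a successor in T; iterating gives a bounded orbit, whose digits
expand the starting point. -/
theorem IsExpanding.subset_selfAffineSet (hA : IsExpanding A) {D : Finset (Fin n → ℤ)}
    {T : Set (Fin n → ℝ)} (hT : IsSelfAffine A D T) : T ⊆ selfAffineSet A D := by
  obtain ⟨hcomp, -, heq⟩ := hT
  intro x hx
  have hstep : ∀ t : T, ∃ s : T, ∃ c ∈ D, realMat A *ᵥ (t : Fin n → ℝ) = s + realVec c := by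
    intro t
    have : realMat A *ᵥ (t : Fin n → ℝ) ∈ ⋃ d ∈ D, (fun x => x + realVec d) '' T :=
      heq ▸ Set.mem_image_of_mem _ t.2
    simp only [Set.mem_iUnion, exists_prop] at this
    obtain ⟨c, hc, s, hs, h⟩ := this
    exact ⟨⟨s, hs⟩, c, hc, h.symm⟩
  choose next digit hdigit hnext using hstep
  obtain ⟨R, hR⟩ := hcomp.isBounded.exists_norm_le
  let y : ℕ → T := fun k => next^[k] ⟨x, hx⟩
  refine hA.mem_selfAffineSet.2 ⟨fun k => digit (y k), fun k => hdigit _, ?_⟩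
  refine (hA.eq_digitSum_of_bounded (fun k => hdigit (y k)) (y := fun k => y k)
    (fun k => hR _ (y k).2) fun k => ?_).symm
  rw [hnext]
  simp only [y, Function.iterate_succ_apply']

/-- T is stable under s ↦ A⁻¹(s + c) for c ∈ D. Composing these maps from a fixed t ∈ T gives points
of T converging to the digit sum, and T is closed. -/
theorem IsExpanding.selfAffineSet_subset (hA : IsExpanding A) {D : Finset (Fin n → ℤ)}
    {T : Set (Fin n → ℝ)} (hT : IsSelfAffine A D T) : selfAffineSet A D ⊆ T := by
  obtain ⟨hcomp, ⟨t, ht⟩, heq⟩ := hT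
  intro x hx
  obtain ⟨d, hd, rfl⟩ := hA.mem_selfAffineSet.1 hx
  have hstep : ∀ c ∈ D, ∀ s ∈ T, (realMat A)⁻¹ *ᵥ (realVec c + s) ∈ T := by
    intro c hc s hs
    have : s + realVec c ∈ (fun x => realMat A *ᵥ x) '' T := by
      rw [heq]
      simp only [Set.mem_iUnion, exists_prop]
      exact ⟨c, hc, s, hs, rfl⟩
    obtain ⟨r, hr, h⟩ := this
    rw [add_comm, ← h]
    simpa only [hA.inv_mulVec_mulVec] using hr
  have key : ∀ (m : ℕ) (d : ℕ → Fin n → ℤ), (∀ k, d k ∈ D) →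
      ∑ k ∈ Finset.range m, (realMat A)⁻¹ ^ (k + 1) *ᵥ realVec (d k) +
        (realMat A)⁻¹ ^ m *ᵥ t ∈ T := by
    intro m
    induction m with
    | zero => intro d hd; simpa using ht
    | succ m ih =>
      intro d hd
      have := hstep _ (hd 0) _ (ih (fun k => d (k + 1)) fun k => hd _)
      rw [Matrix.mulVec_add, Matrix.mulVec_add, Matrix.mulVec_sum, Matrix.mulVec_mulVec,
        ← pow_succ'] at this
      simp_rw [Matrix.mulVec_mulVec, ← pow_succ'] at this
      rw [Finset.sum_range_succ', zero_add, pow_one]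
      convert this using 1
      abel
  have h1 := (hA.hasSum_digitSum hd).tendsto_sum_nat.add
    (hA.tendsto_pow_mulVec (y := fun _ => t) fun _ => le_rfl)
  rw [add_zero] at h1
  exact hcomp.isClosed.mem_of_tendsto h1 (Eventually.of_forall fun m => key m d hd)

theorem IsExpanding.isSelfAffine_iff (hA : IsExpanding A) {D : Finset (Fin n → ℤ)}
    (hD : D.Nonempty) (T : Set (Fin n → ℝ)) : IsSelfAffine A D T ↔ T = selfAffineSet A D :=
  ⟨fun h => (hA.subset_selfAffineSet h).antisymm (hA.selfAffineSet_subset h),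
    fun h => h ▸ hA.isSelfAffine_selfAffineSet hD⟩

end DigitSum

/-! ### Finiteness of the nucleus -/

section Nucleus

variable {n : ℕ} {A : Matrix (Fin n) (Fin n) ℤ}

/-- For an expanding matrix there is a size function on `ℝⁿ` that `A⁻¹` contracts. -/
theorem IsExpanding.exists_contracted_size (hA : IsExpanding A) :
    ∃ (g : (Fin n → ℝ) → ℝ) (K r : ℝ), 0 ≤ K ∧ 0 ≤ r ∧ r < 1 ∧ (∀ x, ‖x‖ ≤ g x) ∧
      (∀ x, g x ≤ K * ‖x‖) ∧ (∀ x y, g (x + y) ≤ g x + g y) ∧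
      ∀ x, g ((realMat A)⁻¹ *ᵥ x) ≤ r * g x := by
  obtain ⟨a, ha, ha0, hbound⟩ := hA.exists_summable_bound
  have hsum : ∀ x, Summable fun k => ‖(realMat A)⁻¹ ^ k *ᵥ x‖ := fun x =>
    Summable.of_nonneg_of_le (fun _ => norm_nonneg _) (fun k => hbound k x) (ha.mul_right _)
  -- The extra 1 ensures K ≥ 1, so that the ratio 1 - K⁻¹ lies in [0, 1).
  set K : ℝ := ∑' k, a k + 1 with hK
  have hK1 : 1 ≤ K := by linarith [tsum_nonneg (L := .unconditional ℕ) ha0]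
  have hgK : ∀ x, ∑' k, ‖(realMat A)⁻¹ ^ k *ᵥ x‖ ≤ K * ‖x‖ := fun x => by
    calc _ ≤ ∑' k, a k * ‖x‖ := (hsum x).tsum_le_tsum (fun k => hbound k x) (ha.mul_right _)
      _ = (∑' k, a k) * ‖x‖ := tsum_mul_right
      _ ≤ K * ‖x‖ := mul_le_mul_of_nonneg_right (by linarith) (norm_nonneg _)
  refine ⟨fun x => ∑' k, ‖(realMat A)⁻¹ ^ k *ᵥ x‖, K, 1 - K⁻¹, by linarith,
    sub_nonneg.2 (inv_le_one_of_one_le₀ hK1), sub_lt_self _ (inv_pos.2 (by linarith)),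
    fun x => ?_, hgK, fun x y => ?_, fun x => ?_⟩
  · simpa using (hsum x).le_tsum 0 fun _ _ => norm_nonneg _
  · rw [← (hsum x).tsum_add (hsum y)]
    refine (hsum _).tsum_le_tsum (fun k => ?_) ((hsum x).add (hsum y))
    rw [Matrix.mulVec_add]
    exact norm_add_le _ _
  -- Dropping the zeroth term gives g(A⁻¹x) = g(x) - ‖x‖, and ‖x‖ ≥ K⁻¹ g(x).
  · have h1 := (hsum x).tsum_eq_zero_add
    simp only [pow_zero, Matrix.one_mulVec, pow_succ, ← Matrix.mulVec_mulVec] at h1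
    have h2 : K⁻¹ * ∑' k, ‖(realMat A)⁻¹ ^ k *ᵥ x‖ ≤ ‖x‖ := by
      rw [inv_mul_le_iff₀ (by linarith)]
      exact hgK x
    linarith

theorem GammaEdge.mulVec_eq {K : Finset (Fin n → ℤ)} {u x y v : Fin n → ℤ}
    (h : GammaEdge A K u x y v) :
    realMat A *ᵥ realVec v = realVec u + realVec x - realVec y := by
  have := congrArg realVec h.2.2
  rw [realVec_add, realVec_add, realVec_mulVec] at this
  rw [this, add_sub_cancel_left]

/-- Along edges the region g ≤ ρ cannot be left, and outside it g strictly decreases or the region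
is entered. A cycle cannot decrease g strictly, so it lies in the region, as does everything
reachable from it. -/
theorem IsExpanding.finite_nucleus (hA : IsExpanding A) (E : Finset (Fin n → ℤ)) :
    (nucleus A E).Finite := by
  obtain ⟨g, K, r, hK, hr0, hr1, hle, hgK, hadd, hcontr⟩ := hA.exists_contracted_size
  obtain ⟨R, hR0, hR⟩ := exists_norm_realVec_le E.finite_toSet
  -- c bounds g on differences of labels, and ρ is the fixed point of s ↦ r(s + c), which bounds the
  -- effect of one edge on g.
  set c : ℝ := K * (R + R) with hc
  set ρ : ℝ := r * c / (1 - r) with hρ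
  have hρ' : r * c = (1 - r) * ρ := by
    rw [hρ, mul_div_cancel₀]
    linarith
  have hedge : ∀ {u v}, GammaAdj A E u v → g (realVec v) ≤ r * g (realVec u) + (1 - r) * ρ := by
    rintro u v ⟨x, y, h⟩
    have h1 : realVec v = (realMat A)⁻¹ *ᵥ (realVec u + (realVec x - realVec y)) := by
      rw [← add_sub_assoc, ← h.mulVec_eq, hA.inv_mulVec_mulVec]
    have h2 : g (realVec x - realVec y) ≤ c := (hgK _).trans (mul_le_mul_of_nonneg_left
      ((norm_sub_le _ _).trans (add_le_add (hR _ h.1) (hR _ h.2.1))) hK)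
    rw [h1, ← hρ', ← mul_add]
    exact (hcontr _).trans (mul_le_mul_of_nonneg_left ((hadd _ _).trans (by linarith)) hr0)
  have hstay : ∀ {u v}, GammaAdj A E u v → g (realVec u) ≤ ρ → g (realVec v) ≤ ρ := by
    intro u v h hu
    nlinarith [hedge h, mul_le_mul_of_nonneg_left hu hr0]
  have hdec : ∀ {u v}, GammaAdj A E u v → g (realVec v) ≤ ρ ∨ g (realVec v) < g (realVec u) := by
    intro u v h
    rcases le_or_gt (g (realVec u)) ρ with hu | hu
    · exact Or.inl (hstay h hu)
    · right
      nlinarith [hedge h, mul_lt_mul_of_pos_left hu (sub_pos.2 hr1)]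
  have htrans : ∀ {u v}, Relation.TransGen (GammaAdj A E) u v →
      g (realVec v) ≤ ρ ∨ g (realVec v) < g (realVec u) := by
    intro u v h
    induction h with
    | single h => exact hdec h
    | tail _ h ih =>
      rcases ih with ih | ih
      · exact Or.inl (hstay h ih)
      · exact (hdec h).imp_right fun h' => h'.trans ih
  refine (finite_setOf_norm_realVec_le ρ).subset ?_
  rintro v ⟨w, hw, hwv⟩
  refine (hle _).trans ?_
  induction hwv with
  | refl => exact (htrans hw).resolve_right (lt_irrefl _)
  | tail _ h ih => exact hstay h ih

/-- The vertices of a left-infinite path with finitely many vertices lie in the nucleus. -/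
theorem mem_nucleus_of_path {E : Finset (Fin n → ℤ)} {p : ℕ → Fin n → ℤ}
    (hp : ∀ k, GammaAdj A E (p (k + 1)) (p k)) (hfin : (Set.range p).Finite) (k : ℕ) :
    p k ∈ nucleus A E := by
  have hpath : ∀ i m, Relation.ReflTransGen (GammaAdj A E) (p (i + m)) (p i) := by
    intro i m
    induction m with
    | zero => exact Relation.ReflTransGen.refl
    | succ m ih => exact Relation.ReflTransGen.head (hp (i + m)) ih
  have : Finite (Set.range p) := hfin
  -- Pigeonhole beyond index k: a repeated vertex lies on a cycle, and the path leads from it down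
  -- to p k.
  obtain ⟨i, j, hij, h⟩ := Finite.exists_ne_map_eq_of_infinite
    fun m : ℕ => (⟨p (k + m), Set.mem_range_self _⟩ : Set.range p)
  have h' : p (k + i) = p (k + j) := congrArg Subtype.val h
  wlog hlt : i < j generalizing i j
  · exact this j i hij.symm h.symm h'.symm (lt_of_le_of_ne (not_lt.1 hlt) hij.symm)
  refine ⟨p (k + i), ?_, hpath k i⟩
  obtain ⟨m, rfl⟩ := Nat.exists_eq_add_of_lt hlt
  have h1 : Relation.TransGen (GammaAdj A E) (p (k + i + m + 1)) (p (k + i)) :=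
    Relation.TransGen.head' (hp _) (hpath _ m)
  have h2 : k + (i + m + 1) = k + i + m + 1 := by ring
  rwa [← h2, ← h'] at h1

end Nucleus

end SelfAffine

namespace SelfAffine

/-! ### Left languages in terms of digit sums -/

section Language

variable {n : ℕ} {A : Matrix (Fin n) (Fin n) ℤ} {E C D : Finset (Fin n → ℤ)}

/-- With d the discarded labels, y_k = p_k + [tail of d from k] satisfies A y_k = y_{k+1} + x_k. It
is bounded because the nucleus is finite, so y_0 = [x]. -/
theorem IsExpanding.digitSum_sub_mem (hA : IsExpanding A) {v : nucleus A E} {x : ℕ → C}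
    (hx : x ∈ (nucleusGraph A E C D).leftLanguage v) :
    digitSum A (fun k => x k) - realVec v ∈ selfAffineSet A D := by
  obtain ⟨p, rfl, hp⟩ := hx
  choose d hd hedge using hp
  obtain ⟨R, hR0, hR⟩ := exists_norm_realVec_le (hA.finite_nucleus E)
  obtain ⟨S, hS⟩ := (hA.isCompact_selfAffineSet D).isBounded.exists_norm_le
  have htail : ∀ k, digitSum A (fun i => d (i + k)) ∈ selfAffineSet A D := fun k =>
    hA.mem_selfAffineSet.2 ⟨_, fun i => hd _, rfl⟩
  have h := hA.eq_digitSum_of_bounded (D := C) (d := fun k => x k) (fun k => (x k).2)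
    (y := fun k => realVec (p k : Fin n → ℤ) + digitSum A fun i => d (i + k)) (R := R + S)
    (fun k => (norm_add_le _ _).trans (add_le_add (hR _ (p k).2) (hS _ (htail k)))) fun k => by
      rw [Matrix.mulVec_add, (hedge k).mulVec_eq, hA.mulVec_digitSum fun i => hd (i + k)]
      simp only [zero_add, add_right_comm _ 1 k, add_assoc _ k 1]
      abel
  rw [← h, add_sub_cancel_left]
  exact htail 0

/-- Digits d of the point determine the path backwards from v through the edge equation. Its
vertices are differences of tail sums, hence bounded and finite in number; thus membership of v in
the nucleus is automatic. -/
theorem IsExpanding.exists_mem_leftLanguage (hA : IsExpanding A) (hDE : D ⊆ E) (hCE : C ⊆ E)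
    {v : Fin n → ℤ} {x : ℕ → C}
    (hx : digitSum A (fun k => x k) - realVec v ∈ selfAffineSet A D) :
    ∃ hv : v ∈ nucleus A E, x ∈ (nucleusGraph A E C D).leftLanguage ⟨v, hv⟩ := by
  obtain ⟨d, hd, hdx⟩ := hA.mem_selfAffineSet.1 hx
  let p : ℕ → Fin n → ℤ := fun k => Nat.rec v (fun k u => d k + A *ᵥ u - x k) k
  have hp : ∀ k, p (k + 1) = d k + A *ᵥ p k - x k := fun _ => rfl
  have hedge : ∀ k, GammaEdge A E (p (k + 1)) (x k) (d k) (p k) := fun k =>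
    ⟨hCE (x k).2, hDE (hd k), by rw [hp, sub_add_cancel]⟩
  have hval : ∀ k, realVec (p k) =
      digitSum A (fun i => x (i + k)) - digitSum A fun i => d (i + k) := by
    intro k
    induction k with
    | zero => simp only [add_zero, hdx, sub_sub_cancel]; rfl
    | succ k ih =>
      have h1 := hA.mulVec_digitSum (D := C) (d := fun i => x (i + k)) fun i => (x (i + k)).2
      have h2 := hA.mulVec_digitSum (D := D) (d := fun i => d (i + k)) fun i => hd (i + k)
      rw [hp, realVec_sub, realVec_add, realVec_mulVec, ih, Matrix.mulVec_sub, h1, h2]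
      simp only [zero_add, add_right_comm _ 1 k, add_assoc _ k 1]
      abel
  obtain ⟨R, hR⟩ := (hA.isCompact_selfAffineSet C).isBounded.exists_norm_le
  obtain ⟨S, hS⟩ := (hA.isCompact_selfAffineSet D).isBounded.exists_norm_le
  have hfin : (Set.range p).Finite := by
    refine (finite_setOf_norm_realVec_le (R + S)).subset ?_
    rintro _ ⟨k, rfl⟩
    rw [Set.mem_ofPred_eq, hval]
    exact (norm_sub_le _ _).trans (add_le_add
      (hR _ (hA.mem_selfAffineSet.2 ⟨_, fun i => (x (i + k)).2, rfl⟩))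
      (hS _ (hA.mem_selfAffineSet.2 ⟨_, fun i => hd (i + k), rfl⟩)))
  have hmem := mem_nucleus_of_path (fun k => ⟨_, _, hedge k⟩) hfin
  exact ⟨hmem 0, fun k => ⟨p k, hmem k⟩, rfl, fun k => ⟨d k, hd k, hedge k⟩⟩

/-- A sequence `x` belongs to `F_v` if and only if `∑_{k ≥ 1} A⁻ᵏ x_k` belongs to `v + T(A, D)`. -/
theorem IsExpanding.mem_leftLanguage_iff (hA : IsExpanding A) (hDE : D ⊆ E) (hCE : C ⊆ E)
    (v : nucleus A E) (x : ℕ → C) :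
    x ∈ (nucleusGraph A E C D).leftLanguage v ↔
      digitSum A (fun k => x k) - realVec v ∈ selfAffineSet A D :=
  ⟨hA.digitSum_sub_mem, fun h => (hA.exists_mem_leftLanguage hDE hCE h).2⟩

theorem IsExpanding.isClosed_leftLanguage (hA : IsExpanding A) (hDE : D ⊆ E) (hCE : C ⊆ E)
    (v : nucleus A E) : IsClosed ((nucleusGraph A E C D).leftLanguage v) := by
  have : (nucleusGraph A E C D).leftLanguage v =
      (fun x : ℕ → C => digitSum A (fun k => x k) - realVec v) ⁻¹' selfAffineSet A D := by
    ext x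
    exact hA.mem_leftLanguage_iff hDE hCE v x
  rw [this]
  exact (hA.isCompact_selfAffineSet D).isClosed.preimage
    ((hA.continuous_digitSum C).sub continuous_const)

theorem LabeledGraph.leftLanguage_prod {V₁ V₂ L : Type*} (G₁ : LabeledGraph V₁ L)
    (G₂ : LabeledGraph V₂ L) (v₁ : V₁) (v₂ : V₂) :
    (G₁.prod G₂).leftLanguage (v₁, v₂) = G₁.leftLanguage v₁ ∩ G₂.leftLanguage v₂ := by
  ext x
  constructor
  · rintro ⟨p, hp0, hp⟩
    exact ⟨⟨fun k => (p k).1, congrArg Prod.fst hp0, fun k => (hp k).1⟩,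
      ⟨fun k => (p k).2, congrArg Prod.snd hp0, fun k => (hp k).2⟩⟩
  · rintro ⟨⟨p, rfl, hp⟩, ⟨q, rfl, hq⟩⟩
    exact ⟨fun k => (p k, q k), rfl, fun k => ⟨hp k, hq k⟩⟩

end Language

end SelfAffine

namespace SelfAffine

open Filter Topology

/-! ### Splitting off the first digit of a random sequence -/

section Bernoulli

variable {n : ℕ} {A : Matrix (Fin n) (Fin n) ℤ} {C : Finset (Fin n → ℤ)}

/-- The sequence with first term `c`, followed by `x`. -/
def consSeq {α : Type*} (c : α) (x : ℕ → α) : ℕ → α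
  | 0 => c
  | k + 1 => x k

theorem measurable_consSeq {α : Type*} [MeasurableSpace α] :
    Measurable fun p : α × (ℕ → α) => consSeq p.1 p.2 := by
  refine measurable_pi_lambda _ fun k => ?_
  cases k with
  | zero => exact measurable_fst
  | succ k => exact (measurable_pi_apply k).comp measurable_snd

/-- Prepending an independent term preserves the product of copies of a probability measure. -/
theorem map_consSeq_prod_infinitePi {α : Type*} [MeasurableSpace α] (u : Measure α)
    [IsProbabilityMeasure u] :
    (u.prod (Measure.infinitePi fun _ : ℕ => u)).map (fun p => consSeq p.1 p.2) =
      Measure.infinitePi fun _ : ℕ => u := by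
  classical
  refine Measure.eq_infinitePi _ fun s t ht => ?_
  obtain ⟨N, hN⟩ : ∃ N, s ⊆ Finset.range (N + 1) :=
    ⟨s.sup id, fun i hi => Finset.mem_range.2 (Nat.lt_succ_of_le (Finset.le_sup (f := id) hi))⟩
  -- Padding to the initial segment 0, …, N lets coordinate 0 split off even when it is not in s.
  let t' : ℕ → Set α := fun i => if i ∈ s then t i else Set.univ
  have ht' : ∀ i, MeasurableSet (t' i) := fun i => by
    simp only [t']
    split_ifs
    exacts [ht i, MeasurableSet.univ]
  have hset : (fun p : α × (ℕ → α) => consSeq p.1 p.2) ⁻¹' Set.pi s t =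
      t' 0 ×ˢ Set.pi (Finset.range N) fun i => t' (i + 1) := by
    ext ⟨c, x⟩
    simp only [Set.mem_preimage, Set.mem_pi, Set.mem_prod, Finset.mem_coe, Finset.mem_range, t']
    constructor
    · intro h
      refine ⟨?_, fun i _ => ?_⟩
      · split_ifs with h0
        exacts [h 0 h0, Set.mem_univ _]
      · split_ifs with hi
        exacts [h (i + 1) hi, Set.mem_univ _]
    · rintro ⟨h0, h⟩ (_ | i) hi
      · simpa [hi, consSeq] using h0
      · have := h i (by have := Finset.mem_range.1 (hN hi); omega)
        simpa [hi, consSeq] using this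
  rw [Measure.map_apply measurable_consSeq
    (MeasurableSet.pi s.countable_toSet fun i _ => ht i), hset, Measure.prod_prod,
    Measure.infinitePi_pi _ fun i _ => ht' (i + 1), mul_comm,
    ← Finset.prod_range_succ' (fun i => u (t' i)), ← Finset.prod_subset hN]
  · exact Finset.prod_congr rfl fun i hi => by simp [t', hi]
  · exact fun i _ hi => by simp [t', hi]

theorem IsCosetTransversal.nonempty (hC : IsCosetTransversal A C) : Nonempty C := by
  obtain ⟨c, ⟨hc, -⟩, -⟩ := hC 0
  exact ⟨⟨c, hc⟩⟩

theorem isProbabilityMeasure_bernoulli [Nonempty C] : IsProbabilityMeasure (bernoulli C) := by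
  rw [bernoulli]
  infer_instance

theorem bernoulli_apply_eq_sum [Nonempty C] {S : Set (ℕ → C)} (hS : MeasurableSet S) :
    bernoulli C S = (C.card : ENNReal)⁻¹ * ∑ c : C, bernoulli C {x | consSeq c x ∈ S} := by
  have := isProbabilityMeasure_bernoulli (C := C)
  conv_lhs =>
    rw [bernoulli, ← map_consSeq_prod_infinitePi, Measure.map_apply measurable_consSeq hS,
      Measure.prod_apply (measurable_consSeq hS), lintegral_fintype]
  rw [Finset.mul_sum]
  refine Finset.sum_congr rfl fun c _ => ?_
  rw [mul_comm]
  congr 1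
  rw [ProbabilityTheory.uniformOn_univ]
  simp

end Bernoulli

/-! ### The periodized digit-sum law is Lebesgue measure -/

section Periodization

variable {n : ℕ} {A : Matrix (Fin n) (Fin n) ℤ} {C : Finset (Fin n → ℤ)}

/-- The sum over all integer translates of the distribution of `∑_{k ≥ 1} A⁻ᵏ x_k` for random
digits `x_k` from `C`. -/
noncomputable def periodizedMeasure (A : Matrix (Fin n) (Fin n) ℤ) (C : Finset (Fin n → ℤ)) :
    Measure (Fin n → ℝ) :=
  Measure.sum fun v : Fin n → ℤ =>
    (bernoulli C).map fun x => digitSum A (fun k => x k) - realVec v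

theorem IsExpanding.measurable_digitSum (hA : IsExpanding A) (C : Finset (Fin n → ℤ)) :
    Measurable fun x : ℕ → C => digitSum A fun k => x k :=
  (hA.continuous_digitSum C).measurable

theorem IsExpanding.periodizedMeasure_apply (hA : IsExpanding A) {B : Set (Fin n → ℝ)}
    (hB : MeasurableSet B) : periodizedMeasure A C B =
      ∑' v : Fin n → ℤ, bernoulli C {x | digitSum A (fun k => x k) - realVec v ∈ B} := by
  rw [periodizedMeasure, Measure.sum_apply _ hB]
  refine tsum_congr fun v => ?_
  rw [Measure.map_apply ((hA.measurable_digitSum C).sub_const _) hB]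
  rfl

theorem measurableSet_add_mem (t : Fin n → ℝ) {B : Set (Fin n → ℝ)} (hB : MeasurableSet B) :
    MeasurableSet {y | y + t ∈ B} :=
  measurable_add_const t hB

theorem IsExpanding.periodizedMeasure_add_realVec (hA : IsExpanding A) (w : Fin n → ℤ)
    {B : Set (Fin n → ℝ)} (hB : MeasurableSet B) :
    periodizedMeasure A C {y | y + realVec w ∈ B} = periodizedMeasure A C B := by
  rw [hA.periodizedMeasure_apply hB, hA.periodizedMeasure_apply (measurableSet_add_mem _ hB),
    ← (Equiv.addRight w).tsum_eq]
  refine tsum_congr fun v => ?_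
  simp [← sub_sub]

theorem IsExpanding.mulVec_intCast_injective (hA : IsExpanding A) :
    Function.Injective (fun v : Fin n → ℤ => A *ᵥ v) := fun u v h =>
  realVec_injective (hA.mulVec_injective (by simpa using congrArg realVec h))

/-- Every integer vector is uniquely of the form `A v - c` with `c` in a coset transversal. -/
theorem IsCosetTransversal.bijective (hA : IsExpanding A) (hC : IsCosetTransversal A C) :
    Function.Bijective fun p : (Fin n → ℤ) × C => A *ᵥ p.1 - (p.2 : Fin n → ℤ) := by
  constructor
  · rintro ⟨u, c⟩ ⟨v, d⟩ h
    simp only at h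
    have hcd : (c : Fin n → ℤ) = d := (hC (-(A *ᵥ u - c))).unique
      ⟨c.2, -u, by rw [Matrix.mulVec_neg]; abel⟩ ⟨d.2, -v, by rw [h, Matrix.mulVec_neg]; abel⟩
    rw [hcd, sub_left_inj] at h
    exact Prod.ext (hA.mulVec_intCast_injective h) (Subtype.ext hcd)
  · intro z
    obtain ⟨c, ⟨hc, w, hw⟩, -⟩ := hC (-z)
    refine ⟨(-w, ⟨c, hc⟩), ?_⟩
    simp only [Matrix.mulVec_neg]
    rw [← neg_neg z, hw]
    abel

theorem IsExpanding.digitSum_consSeq (hA : IsExpanding A) (c : C) (x : ℕ → C) :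
    digitSum A (fun k => (consSeq c x k : C)) =
      (realMat A)⁻¹ *ᵥ (digitSum A (fun k => x k) + realVec c) := by
  have := hA.mulVec_digitSum (D := C) (d := fun k => (consSeq c x k : C)) fun k => (consSeq c x k).2
  rw [← hA.inv_mulVec_mulVec (digitSum A _), this]
  rfl

theorem measurableSet_inv_mulVec_mem (A : Matrix (Fin n) (Fin n) ℤ) {B : Set (Fin n → ℝ)}
    (hB : MeasurableSet B) : MeasurableSet {y | (realMat A)⁻¹ *ᵥ y ∈ B} :=
  (Continuous.matrix_mulVec continuous_const continuous_id).measurable hB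

/-- The periodized measure is scaled by the index of the sublattice. -/
theorem IsExpanding.periodizedMeasure_scale (hA : IsExpanding A) (hC : IsCosetTransversal A C)
    {B : Set (Fin n → ℝ)} (hB : MeasurableSet B) :
    periodizedMeasure A C B =
      (C.card : ENNReal)⁻¹ * periodizedMeasure A C {y | (realMat A)⁻¹ *ᵥ y ∈ B} := by
  have := hC.nonempty
  have hmeas : ∀ v : Fin n → ℤ,
      MeasurableSet {x : ℕ → C | digitSum A (fun k => x k) - realVec v ∈ B} := fun v =>
    ((hA.measurable_digitSum C).sub_const _) hB
  rw [hA.periodizedMeasure_apply hB, hA.periodizedMeasure_apply (measurableSet_inv_mulVec_mem A hB)]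
  -- Integer translates on the right are indexed as A v - c, matching [c x] - v = A⁻¹([x] - (A v -
  -- c)).
  refine Eq.trans ?_ (congrArg _ ((Equiv.ofBijective _ (hC.bijective hA)).tsum_eq _))
  rw [ENNReal.tsum_prod', ← ENNReal.tsum_mul_left]
  refine tsum_congr fun v => ?_
  rw [bernoulli_apply_eq_sum (hmeas v), tsum_fintype]
  congr 1
  refine Finset.sum_congr rfl fun c _ => ?_
  congr 1
  ext x
  simp only [Set.mem_ofPred_eq, hA.digitSum_consSeq, Equiv.ofBijective_apply, realVec_sub,
    realVec_mulVec]
  rw [sub_sub_eq_add_sub, Matrix.mulVec_sub, hA.inv_mulVec_mulVec]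

/-- Scaling by A turns a translation by A⁻⁽ʲ⁺¹⁾w into one by A⁻ʲw. -/
theorem IsExpanding.periodizedMeasure_add_pow (hA : IsExpanding A) (hC : IsCosetTransversal A C)
    (w : Fin n → ℤ) (j : ℕ) {B : Set (Fin n → ℝ)} (hB : MeasurableSet B) :
    periodizedMeasure A C {y | y + (realMat A)⁻¹ ^ j *ᵥ realVec w ∈ B} =
      periodizedMeasure A C B := by
  induction j generalizing B with
  | zero => simpa using hA.periodizedMeasure_add_realVec w hB
  | succ j ih =>
    have h := ih (measurableSet_inv_mulVec_mem A hB)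
    rw [hA.periodizedMeasure_scale hC (measurableSet_add_mem _ hB),
      hA.periodizedMeasure_scale hC hB]
    congr 1
    refine Eq.trans ?_ h
    congr 1
    ext y
    simp only [Set.mem_ofPred_eq, Matrix.mulVec_add, Matrix.mulVec_mulVec,
      ← pow_succ']

/-- Rounding Aʲt to an integer vector makes a bounded error, which A⁻ʲ sends to 0. -/
theorem IsExpanding.exists_tendsto (hA : IsExpanding A) (t : Fin n → ℝ) :
    ∃ w : ℕ → Fin n → ℤ, Tendsto (fun j => (realMat A)⁻¹ ^ j *ᵥ realVec (w j)) atTop (𝓝 t) := by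
  refine ⟨fun j i => ⌊(realMat A ^ j *ᵥ t) i⌋, ?_⟩
  have h := hA.tendsto_pow_mulVec (R := 1)
    (y := fun j => realMat A ^ j *ᵥ t - realVec fun i => ⌊(realMat A ^ j *ᵥ t) i⌋) fun j => by
      refine (pi_norm_le_iff_of_nonneg zero_le_one).2 fun i => ?_
      have h0 := Int.floor_le ((realMat A ^ j *ᵥ t) i)
      have h1 := Int.lt_floor_add_one ((realMat A ^ j *ᵥ t) i)
      rw [Pi.sub_apply, Real.norm_eq_abs, abs_le]
      simp only [realVec]
      constructor <;> linarith
  have h2 := (tendsto_const_nhds (x := t)).sub h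
  rw [sub_zero] at h2
  refine h2.congr fun j => ?_
  have hinv : (realMat A)⁻¹ ^ j * realMat A ^ j = 1 := by
    rw [Matrix.inv_pow', Matrix.nonsing_inv_mul]
    rw [Matrix.det_pow]
    exact hA.isUnit_det.pow j
  rw [Matrix.mulVec_sub, Matrix.mulVec_mulVec, hinv, Matrix.one_mulVec, sub_sub_cancel]

/-- A Fatou argument: if t_j → t and y + t ∈ U with U open, then y + t_j ∈ U for all large j. The
increasing sets S N each have measure at most that of U, by invariance under t_N. -/
theorem IsExpanding.periodizedMeasure_add_le (hA : IsExpanding A) (hC : IsCosetTransversal A C)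
    (t : Fin n → ℝ) {U : Set (Fin n → ℝ)} (hU : IsOpen U) :
    periodizedMeasure A C {y | y + t ∈ U} ≤ periodizedMeasure A C U := by
  obtain ⟨w, hw⟩ := hA.exists_tendsto t
  let S : ℕ → Set (Fin n → ℝ) := fun N =>
    ⋂ j ≥ N, {y | y + (realMat A)⁻¹ ^ j *ᵥ realVec (w j) ∈ U}
  have hS : Monotone S := fun N M h => Set.biInter_subset_biInter_left fun j hj => le_trans h hj
  have hsub : {y | y + t ∈ U} ⊆ ⋃ N, S N := by
    intro y hy
    have : ∀ᶠ j in atTop, y + (realMat A)⁻¹ ^ j *ᵥ realVec (w j) ∈ U :=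
      (tendsto_const_nhds.add hw).eventually_mem (hU.mem_nhds hy)
    obtain ⟨N, hN⟩ := eventually_atTop.1 this
    exact Set.mem_iUnion.2 ⟨N, Set.mem_iInter₂.2 hN⟩
  refine (measure_mono hsub).trans ?_
  rw [hS.measure_iUnion]
  refine iSup_le fun N => ?_
  rw [← hA.periodizedMeasure_add_pow hC (w N) N hU.measurableSet]
  exact measure_mono (Set.biInter_subset_of_mem (le_refl N))

theorem IsExpanding.periodizedMeasure_add (hA : IsExpanding A) (hC : IsCosetTransversal A C)
    (t : Fin n → ℝ) {U : Set (Fin n → ℝ)} (hU : IsOpen U) :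
    periodizedMeasure A C {y | y + t ∈ U} = periodizedMeasure A C U := by
  refine (hA.periodizedMeasure_add_le hC t hU).antisymm ?_
  have := hA.periodizedMeasure_add_le hC (-t) (U := {y | y + t ∈ U})
    (hU.preimage (continuous_add_const t))
  simpa using this

/-- Every translate of the half-open unit cube has measure `1` for the periodized measure. -/
theorem IsExpanding.periodizedMeasure_cube (hA : IsExpanding A) (hC : IsCosetTransversal A C)
    (s : Fin n → ℝ) :
    periodizedMeasure A C {y | y - s ∈ Set.pi Set.univ fun _ => Set.Ico (0 : ℝ) 1} = 1 := by
  have := hC.nonempty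
  have := isProbabilityMeasure_bernoulli (C := C)
  have hQ : MeasurableSet {y | y - s ∈ Set.pi Set.univ fun _ : Fin n => Set.Ico (0 : ℝ) 1} :=
    measurable_id.sub_const s (MeasurableSet.univ_pi fun _ => measurableSet_Ico)
  -- Exactly one integer translate of y lands in the cube, so the events indexed by v partition the
  -- probability space.
  have hiff : ∀ (y : Fin n → ℝ) (v : Fin n → ℤ),
      y - realVec v - s ∈ Set.pi Set.univ (fun _ : Fin n => Set.Ico (0 : ℝ) 1) ↔
        (fun i => ⌊(y - s) i⌋) = v := by
    intro y v
    simp only [Set.mem_univ_pi, funext_iff, Int.floor_eq_iff, Set.mem_Ico, realVec, Pi.sub_apply]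
    refine forall_congr' fun i => and_congr ?_ ?_ <;> constructor <;> intro h <;> linarith
  rw [hA.periodizedMeasure_apply hQ, ← measure_iUnion, ← measure_univ (μ := bernoulli C)]
  · congr 1
    refine Set.eq_univ_of_forall fun x => Set.mem_iUnion.2 ⟨_, (hiff _ _).2 rfl⟩
  · intro u v huv
    refine Set.disjoint_left.2 fun x hu hv => huv ?_
    exact ((hiff _ _).1 hu).symm.trans ((hiff _ _).1 hv)
  · exact fun v => ((hA.measurable_digitSum C).sub_const _) hQ

/-- The cube bound gives local finiteness, hence outer regularity, which extends translation
invariance from open sets to all sets. Haar uniqueness leaves a constant, fixed by the unit cube. -/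
theorem IsExpanding.periodizedMeasure_eq_volume (hA : IsExpanding A)
    (hC : IsCosetTransversal A C) : periodizedMeasure A C = volume := by
  have hfin : IsLocallyFiniteMeasure (periodizedMeasure A C) := by
    refine ⟨fun x => ⟨Metric.ball x (1 / 2), Metric.ball_mem_nhds x (by norm_num), ?_⟩⟩
    refine (measure_mono fun y hy => ?_).trans_lt
      ((hA.periodizedMeasure_cube hC (x - fun _ => 1 / 2)).trans_lt ENNReal.one_lt_top)
    rw [Set.mem_ofPred_eq, Set.mem_univ_pi]
    intro i
    have := (dist_le_pi_dist y x i).trans_lt hy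
    rw [Real.dist_eq, abs_lt] at this
    simp only [Pi.sub_apply, Set.mem_Ico]
    constructor <;> linarith [this.1, this.2]
  have hinv : (periodizedMeasure A C).IsAddLeftInvariant := by
    refine ⟨fun t => ?_⟩
    have : ((periodizedMeasure A C).map (t + ·)).OuterRegular :=
      Measure.OuterRegular.map (Homeomorph.addLeft t) _
    refine Measure.OuterRegular.ext_isOpen fun U hU => ?_
    rw [Measure.map_apply (measurable_const_add t) hU.measurableSet,
      ← hA.periodizedMeasure_add hC t hU]
    simp only [add_comm _ t]
    rfl
  have h := Measure.isAddLeftInvariant_eq_smul (periodizedMeasure A C) volume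
  have hcube := hA.periodizedMeasure_cube hC 0
  rw [h] at hcube
  simp only [sub_zero, Set.ofPred_mem_eq, Measure.smul_apply, Real.volume_pi_Ico] at hcube
  simp at hcube
  rw [h, hcube, one_smul]

end Periodization

end SelfAffine

theorem mainTheorem4 (n : ℕ) (A : Matrix (Fin n) (Fin n) ℤ) (hA : SelfAffine.IsExpanding A)
    (D₁ D₂ E C : Finset (Fin n → ℤ)) (hC : SelfAffine.IsCosetTransversal A C)
    (hD₁E : D₁ ⊆ E) (hD₂E : D₂ ⊆ E) (hCE : C ⊆ E) :
    -- `T(A, D)` is the unique nonempty compact solution of `A(T) = ⋃_{d ∈ D} (T + d)`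
    (∀ D : Finset (Fin n → ℤ), D.Nonempty → ∀ T : Set (Fin n → ℝ),
      SelfAffine.IsSelfAffine A D T ↔ T = SelfAffine.selfAffineSet A D) ∧
    -- the nucleus is finite and the sets `F_v` are closed
    (SelfAffine.nucleus A E).Finite ∧
    (∀ v : SelfAffine.nucleus A E,
      IsClosed ((SelfAffine.nucleusGraph A E C D₁).leftLanguage v) ∧
      IsClosed ((SelfAffine.nucleusGraph A E C D₂).leftLanguage v)) ∧
    -- the formula for the measure of the intersection
    volume (SelfAffine.selfAffineSet A D₁ ∩ SelfAffine.selfAffineSet A D₂) =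
      ∑' v : SelfAffine.nucleus A E, SelfAffine.bernoulli C
        ((SelfAffine.nucleusGraph A E C D₁).leftLanguage v ∩
          (SelfAffine.nucleusGraph A E C D₂).leftLanguage v) ∧
    -- the intersections are read off the labeled product graph
    (∀ v₁ v₂ : SelfAffine.nucleus A E,
      ((SelfAffine.nucleusGraph A E C D₁).prod
          (SelfAffine.nucleusGraph A E C D₂)).leftLanguage (v₁, v₂) =
        (SelfAffine.nucleusGraph A E C D₁).leftLanguage v₁ ∩
          (SelfAffine.nucleusGraph A E C D₂).leftLanguage v₂) := by
  refine ⟨fun D hD T => hA.isSelfAffine_iff hD T, hA.finite_nucleus E,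
    fun v => ⟨hA.isClosed_leftLanguage hD₁E hCE v, hA.isClosed_leftLanguage hD₂E hCE v⟩, ?_,
    fun v₁ v₂ => SelfAffine.LabeledGraph.leftLanguage_prod _ _ v₁ v₂⟩
  rw [← hA.periodizedMeasure_eq_volume hC, hA.periodizedMeasure_apply
    ((hA.isCompact_selfAffineSet D₁).measurableSet.inter
      (hA.isCompact_selfAffineSet D₂).measurableSet)]
  -- The sum over ℤⁿ reduces to the nucleus: a nonzero term supplies an x with [x] - v ∈ T₁, which
  -- forces v into it.
  rw [← tsum_subtype_eq_of_support_subset (s := SelfAffine.nucleus A E)]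
  · refine tsum_congr fun v => congrArg _ ?_
    ext x
    exact and_congr (hA.mem_leftLanguage_iff hD₁E hCE v x).symm
      (hA.mem_leftLanguage_iff hD₂E hCE v x).symm
  · intro v hv
    obtain ⟨x, hx⟩ := nonempty_of_measure_ne_zero hv
    exact (hA.exists_mem_leftLanguage hD₁E hCE hx.1).1
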